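/- \textbf{Setting.} Let $Ap$ be a finite set of atomic propositions and let $\mathcal M=(S,\mathbf P,\mu,Ap,L)$ be a labelled Markov chain with finite state set $S$, transition probabilities $\mathbf P$, initial distribution $\mu$ and labelling $L:S\to 2^{Ap}$. Let $\varphi$ be an LTL formula over $Ap$, and write $\mathbb P[\mathcal M\models\varphi]$ for the probability that the label sequence $L(s_0)L(s_1)\cdots$ of a run $s_0s_1\cdots$ of $\mathcal M$ satisfies $\varphi$. Let $\mathcal A=(Q,2^{Ap},\gamma,q_o,Acc)$ be any deterministic Rabin automaton (with $Q$ finite and $Acc\subseteq 2^Q\times 2^Q$) that accepts exactly the infinite words over $2^{Ap}$ satisfying $\varphi$, where a word is accepted if for some $(E,F)\in Acc$ its run visits no state of $E$ infinitely often and at least one state of $F$ infinitely often. The product $\mathcal M\otimes\mathcal A$ is the Markov chain on $S\times Q$ with $\mathbf P'((s,q),(s',q'))=\mathbf P(s,s')$ if $q'=\gamma(q,L(s'))$ and $0$ otherwise, and $\mu'(s,q)=\mu(s)$ if $q=\gamma(q_o,L(s))$ and $0$ otherwise. \textbf{Candidates and bad paths.} The graph $G_\pi$ of a finite path $\pi$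 has the entries of $\pi$ as vertices and the pairs of consecutive entries as edges. A graph is strongly connected if it is nonempty and for all (possibly equal) vertices $v,v'$ there is a path with at least one edge from $v$ to $v'$ (so a single vertex without a self-loop is not strongly connected). An SCC is a maximal strongly connected subgraph; it is a bottom SCC (BSCC) if no edge leaves it. If $\pi$ has a suffix $\kappa$ such that $G_\kappa$ is a BSCC of $G_\pi$, the set of entries of $\kappa$ is the candidate $K(\pi)$ of $\pi$; otherwise $\pi$ has no candidate. A candidate $K$ is good if for some $(E,F)\in Acc$ we have $K\cap(S\times E)=\emptyset$ and $K\cap(S\times F)\ne\emptyset$, and bad otherwise. A path is bad if it has a candidate and the candidate is bad; in particular the empty path $\lambda$ is not bad. \textbf{The monitor.} $\mathcal C$ is the infinite-state Markov chain whose states are pairs $\langle\pi,r\rangle$, with $\pi$ a finite path of $\mathcal M\otimes\mathcal A$ and $r\ge 0$ an integer, started in $\langle\lambda,0\rangle$. If $\pi$ is bad, $\langle\pi,r\rangle$ moves to $\langle\lambda,r+1\rangle$ with probability $1$ (a reset). If $\pi$ is not bad, $\langle\pi,r\rangle$ moves to $\langle\pi.p',r\rangle$ with probability $\mathbf P'(p,p')$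 if $\pi$ ends in $p$, and with probability $\mu'(p')$ if $\pi=\lambda$. For a run $\rho=\langle\pi_0,r_0\rangle\langle\pi_1,r_1\rangle\cdots$ of $\mathcal C$ let $R(\rho)=\sup_i r_i$ be the number of resets. Let $S_\varphi$ be the set of runs $\rho$ with $R(\rho)<\infty$ such that the suffix of $\rho$ starting immediately after the last reset (all of $\rho$ if there is no reset) satisfies $\varphi$, i.e. the infinite path of $\mathcal M\otimes\mathcal A$ whose prefixes are the paths stored in the states of this suffix has a label sequence that satisfies $\varphi$. \textbf{Theorem.} If $\mathbb P[\mathcal M\models\varphi]>0$, then \begin{itemize} \item[(a)] $\mathbb P_{\mathcal C}[R<\infty]=1$; \item[(b)] $\mathbb P_{\mathcal C}[S_\varphi\mid R<\infty]=\mathbb P_{\mathcal C}[S_\varphi]=1$. \end{itemize} -/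

import Mathlib

open MeasureTheory ProbabilityTheory
open scoped ENNReal

noncomputable section

namespace Monitoring

/-! ### Directed graphs -/

/-- A directed graph `(V, E)` with `V` a set of vertices in an ambient type and `E ⊆ V × V`. -/
@[ext]
structure DirGraph (α : Type*) where
  verts : Set α
  edges : Set (α × α)
  edges_subset : edges ⊆ verts ×ˢ verts

namespace DirGraph

variable {α : Type*}

/-- `H.IsSubgraph G` is `H ≼ G`. -/
def IsSubgraph (H G : DirGraph α) : Prop :=
  H.verts ⊆ G.verts ∧ H.edges ⊆ G.edges

/-- A nonempty graph is strongly connected if every two (possibly equal) vertices `v`, `v'` are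
connected by a path from `v` to `v'` with at least one edge. In particular a single vertex without
a self-loop is not strongly connected. -/
def StronglyConnected (G : DirGraph α) : Prop :=
  G.verts.Nonempty ∧
    ∀ v ∈ G.verts, ∀ v' ∈ G.verts, Relation.TransGen (fun a b => (a, b) ∈ G.edges) v v'

/-- `H` is a strongly connected component of `G`: a maximal strongly connected subgraph. -/
def IsSCC (H G : DirGraph α) : Prop :=
  H.IsSubgraph G ∧ H.StronglyConnected ∧
    ∀ H' : DirGraph α, H.IsSubgraph H' → H'.IsSubgraph G → H'.StronglyConnected → H' = H

/-- `H` is a bottom strongly connected component of `G`. -/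
def IsBSCC (H G : DirGraph α) : Prop :=
  H.IsSCC G ∧ ∀ v v', v ∈ H.verts → (v, v') ∈ G.edges → v' ∈ H.verts

end DirGraph

/-- The graph of a finite path: its vertices are the entries of the path, its edges are the pairs
of consecutive entries. -/
def pathGraph {α : Type*} (π : List α) : DirGraph α where
  verts := {v | v ∈ π}
  edges := {e | [e.1, e.2] <:+: π}
  edges_subset := fun _ he => ⟨he.subset (by simp), he.subset (by simp)⟩

/-- `K` is the candidate of the finite path `π`: the support of a suffix `κ` of `π` whose graph is a
bottom strongly connected component of the graph of `π`. -/
def IsCandidate {α : Type*} (π : List α) (K : Set α) : Prop :=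
  ∃ κ : List α, κ <:+ π ∧ (pathGraph κ).IsBSCC (pathGraph π) ∧ K = {v | v ∈ κ}

/-! ### Markov chains -/

/-- A (discrete-time, homogeneous) Markov chain: an initial distribution and, for every state, the
distribution of the next state, so that `M.step s s'` is the transition probability from `s` to
`s'`. -/
structure MarkovChain (α : Type*) where
  init : PMF α
  step : α → PMF α

namespace MarkovChain

variable {α : Type*} [MeasurableSpace α] [DiscreteMeasurableSpace α]

/-- The transition kernel from the first `n + 1` states of a run to the next state. -/
def kernel (M : MarkovChain α) (n : ℕ) : Kernel (Π _ : Finset.Iic n, α) α where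
  toFun h := (M.step (h ⟨n, Finset.mem_Iic.2 le_rfl⟩)).toMeasure
  measurable' :=
    (Measurable.of_discrete (f := fun s : α => (M.step s).toMeasure)).comp
      (measurable_pi_apply _)

instance (M : MarkovChain α) (n : ℕ) : IsMarkovKernel (M.kernel n) :=
  ⟨fun h => inferInstanceAs
    (IsProbabilityMeasure (M.step (h ⟨n, Finset.mem_Iic.2 le_rfl⟩)).toMeasure)⟩

/-- The law of the runs of the chain, as a probability measure on sequences of states. -/
def law (M : MarkovChain α) : Measure (ℕ → α) :=
  Kernel.trajMeasure (X := fun _ => α) M.init.toMeasure M.kernel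

end MarkovChain

/-- A labelled Markov chain, with labels in `2^Ap`. -/
structure LabelledMarkovChain (S Ap : Type*) extends MarkovChain S where
  label : S → Set Ap

/-! ### Linear temporal logic -/

/-- Formulas of linear temporal logic over the atomic propositions `Ap`. -/
inductive LTL (Ap : Type*) where
  | tt : LTL Ap
  | atom (a : Ap) : LTL Ap
  | neg (φ : LTL Ap) : LTL Ap
  | and (φ ψ : LTL Ap) : LTL Ap
  | next (φ : LTL Ap) : LTL Ap
  | until (φ ψ : LTL Ap) : LTL Ap

/-- Satisfaction of a formula by an infinite word over `2^Ap`. -/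
def LTL.Sat {Ap : Type*} : LTL Ap → (ℕ → Set Ap) → Prop
  | .tt, _ => True
  | .atom a, w => a ∈ w 0
  | .neg φ, w => ¬ φ.Sat w
  | .and φ ψ, w => φ.Sat w ∧ ψ.Sat w
  | .next φ, w => φ.Sat (fun i => w (i + 1))
  | .until φ ψ, w =>
      ∃ n, ψ.Sat (fun i => w (i + n)) ∧ ∀ m < n, φ.Sat (fun i => w (i + m))

/-- The probability `ℙ[M ⊨ φ]` that the label sequence of a run of `M` satisfies `φ`. -/
def LabelledMarkovChain.probSat {S Ap : Type*} [MeasurableSpace S] [DiscreteMeasurableSpace S]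
    (M : LabelledMarkovChain S Ap) (φ : LTL Ap) : ℝ≥0∞ :=
  M.law {ρ | φ.Sat (fun i => M.label (ρ i))}

/-! ### Deterministic Rabin automata -/

/-- A deterministic Rabin automaton over the alphabet `2^Ap`; `acc` is its set of Rabin pairs
`(E, F)`. -/
structure RabinAutomaton (Q Ap : Type*) where
  trans : Q → Set Ap → Q
  start : Q
  acc : Set (Set Q × Set Q)

namespace RabinAutomaton

variable {Q Ap : Type*}

/-- The run of the automaton on an infinite word. -/
def run (A : RabinAutomaton Q Ap) (w : ℕ → Set Ap) : ℕ → Q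
  | 0 => A.start
  | n + 1 => A.trans (A.run w n) (w n)

/-- The set of states that the run on `w` visits infinitely often. -/
def infStates (A : RabinAutomaton Q Ap) (w : ℕ → Set Ap) : Set Q :=
  {q | ∀ N, ∃ n, N ≤ n ∧ A.run w n = q}

/-- Rabin acceptance: for some pair `(E, F)`, no state of `E` and at least one state of `F` is
visited infinitely often. -/
def Accepts (A : RabinAutomaton Q Ap) (w : ℕ → Set Ap) : Prop :=
  ∃ P ∈ A.acc, A.infStates w ∩ P.1 = ∅ ∧ (A.infStates w ∩ P.2).Nonempty

/-- `A` is an automaton for `φ`: it accepts exactly the words that satisfy `φ`. -/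
def Recognizes (A : RabinAutomaton Q Ap) (φ : LTL Ap) : Prop :=
  ∀ w : ℕ → Set Ap, A.Accepts w ↔ φ.Sat w

end RabinAutomaton

/-! ### The product chain and the cautious monitor -/

section Cautious

variable {S Q Ap : Type*}

/-- The product `M ⊗ A`: a move of `M` into `s'` moves the automaton from `q` to `γ(q, L(s'))`; the
automaton has read the label of the first state already. -/
def product (M : LabelledMarkovChain S Ap) (A : RabinAutomaton Q Ap) : MarkovChain (S × Q) where
  init := M.init.map fun s => (s, A.trans A.start (M.label s))
  step p := (M.step p.1).map fun s' => (s', A.trans p.2 (M.label s'))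

/-- A set `K` of product states is good if for some Rabin pair `(E, F)` it avoids `S × E` and meets
`S × F`. -/
def GoodSet (A : RabinAutomaton Q Ap) (K : Set (S × Q)) : Prop :=
  ∃ P ∈ A.acc, K ∩ (Set.univ ×ˢ P.1) = ∅ ∧ (K ∩ (Set.univ ×ˢ P.2)).Nonempty

/-- A finite path is bad if it has a candidate and this candidate is not good. -/
def BadPath (A : RabinAutomaton Q Ap) (π : List (S × Q)) : Prop :=
  ∃ K, IsCandidate π K ∧ ¬ GoodSet A K

/-- The states `⟨π, r⟩` of the chain of the monitor: the path since the last reset and the number of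
resets so far. (Lists that are not paths of the product chain are never reached.) -/
@[ext]
structure MonitorState (V : Type*) where
  path : List V
  resets : ℕ

instance (V : Type*) : MeasurableSpace (MonitorState V) := ⊤

instance (V : Type*) : DiscreteMeasurableSpace (MonitorState V) := ⟨fun _ => trivial⟩

/-- The distribution of the next state of a chain after the finite path `π`: the initial
distribution if `π` is empty, and the transition distribution of the last state otherwise. -/
def MarkovChain.nextState {V : Type*} (N : MarkovChain V) (π : List V) : PMF V :=
  match π.getLast? with
  | none => N.init
  | some p => N.step p

open Classical in
/-- The infinite-state Markov chain `C` of the cautious monitor. It starts in `⟨λ, 0⟩`. From `⟨π, r⟩`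
it moves to `⟨λ, r + 1⟩` if `π` is bad (a reset), and otherwise it extends `π` by a next state of
the product chain. -/
def cautiousChain (M : LabelledMarkovChain S Ap) (A : RabinAutomaton Q Ap) :
    MarkovChain (MonitorState (S × Q)) where
  init := PMF.pure ⟨[], 0⟩
  step x :=
    if BadPath A x.path then PMF.pure ⟨[], x.resets + 1⟩
    else ((product M A).nextState x.path).map fun p => ⟨x.path ++ [p], x.resets⟩

/-- The number of resets `R`: the supremum of the reset counters along a run of the monitor. -/
def numResets {V : Type*} (ρ : ℕ → MonitorState V) : ℕ∞ :=
  ⨆ n, ((ρ n).resets : ℕ∞)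

/-- The suffix of `ρ` from time `n` on starts immediately after the last reset (or is the whole run,
if there are no resets): no transition from time `n` on is a reset, and the transition into time
`n`, if there is one, is a reset. The resets are the transitions out of bad paths. -/
def StartsAfterLastReset (A : RabinAutomaton Q Ap) (ρ : ℕ → MonitorState (S × Q)) (n : ℕ) : Prop :=
  (∀ m, n ≤ m → ¬ BadPath A (ρ m).path) ∧ ∀ m, n = m + 1 → BadPath A (ρ m).path

/-- The suffix of `ρ` from time `n` on satisfies `φ`: the paths stored in its states are the prefixes
of an infinite sequence `w` of product states, and the label sequence of `w` satisfies `φ`. -/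
def SuffixSat (M : LabelledMarkovChain S Ap) (φ : LTL Ap) (ρ : ℕ → MonitorState (S × Q))
    (n : ℕ) : Prop :=
  ∃ w : ℕ → S × Q, (∀ k, (ρ (n + k)).path = (List.range k).map w) ∧
    φ.Sat (fun i => M.label (w i).1)

/-- The event `S_φ`: there are finitely many resets, and the suffix that starts immediately after the
last reset satisfies `φ`. -/
def successEvent (M : LabelledMarkovChain S Ap) (A : RabinAutomaton Q Ap) (φ : LTL Ap) :
    Set (ℕ → MonitorState (S × Q)) :=
  {ρ | numResets ρ < ⊤ ∧ ∃ n, StartsAfterLastReset A ρ n ∧ SuffixSat M φ ρ n}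

end Cautious

end Monitoring

end

namespace Monitoring

open Filter

/-! ### Almost sure properties of the runs of a countable Markov chain -/

namespace MarkovChain

variable {α : Type*} [MeasurableSpace α] [DiscreteMeasurableSpace α]

/-! Both claims follow from deterministic facts about runs that are fair in the sense of
`IsFairRun`. Almost every run is fair: by Lévy's conditional Borel–Cantelli lemma
(`ae_frequently_step`), a move whose probability is bounded below at infinitely many times is made
infinitely often.

Finitely many resets. Since `φ` has positive probability, some run of the product is accepted and
has an infinity set that is closed under moves and good. Fix `f` in this set at a state that the
Rabin pair must visit. A path is safe if each entry, when appended, is new or can return to `f`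
along edges already seen. A candidate of a safe path contains `f` and only states reachable from
`f`, hence is good (`SafePath.mem_candidate`). A safe path can enter the closed set and then tour
all of it, returning to `f` each time; after the tour every continuation is safe
(`exists_safe_covering`). With infinitely many resets the empty path recurs, so by fairness the tour
occurs as a stored path, after which no reset is possible: a contradiction.

Correctness. After the last reset the stored paths grow to an infinite path `w`. By fairness `infSet
w` is closed under moves, so it is the candidate of some prefix (`exists_isCandidate_infSet`). That
prefix is not bad, so `infSet w` is good; this is Rabin acceptance of the labels of `w`, so they
satisfy `φ`. -/

instance (M : MarkovChain α) : IsProbabilityMeasure M.law := by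
  unfold law; infer_instance

theorem map_eval_zero_law (M : MarkovChain α) :
    M.law.map (fun ρ => ρ 0) = M.init.toMeasure := by
  have h : (fun ρ : ℕ → α => ρ 0) =
      (MeasurableEquiv.piUnique (fun _ : Finset.Iic 0 => α)) ∘
        (Preorder.frestrictLe (π := fun _ => α) 0) := rfl
  rw [h, ← Measure.map_map (by fun_prop) (by fun_prop), law, Kernel.trajMeasure,
    Measure.map_comp _ _ (by fun_prop), Kernel.traj_map_frestrictLe_of_le le_rfl,
    Measure.deterministic_comp_eq_map]
  have h2 : Preorder.frestrictLe₂ (π := fun _ => α) (le_refl 0) = id := rfl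
  rw [h2, Measure.map_id, Measure.map_map (by fun_prop) (by fun_prop)]
  exact (congrArg (fun f => M.init.toMeasure.map f)
    (MeasurableEquiv.self_comp_symm _)).trans Measure.map_id

theorem ae_init_ne_zero (M : MarkovChain α) : ∀ᵐ ρ ∂M.law, M.init (ρ 0) ≠ 0 := by
  refine ae_of_ae_map (f := fun ρ : ℕ → α => ρ 0) (p := fun s => M.init s ≠ 0)
    (measurable_pi_apply 0).aemeasurable ?_
  rw [map_eval_zero_law, ae_iff, PMF.toMeasure_apply_eq_zero_iff _ (.of_discrete)]
  exact Set.disjoint_left.2 fun s hs hs' => hs' hs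

variable [Countable α]

theorem ae_step_ne_zero (M : MarkovChain α) :
    ∀ᵐ ρ ∂M.law, ∀ k, M.step (ρ k) (ρ (k + 1)) ≠ 0 := by
  refine ae_all_iff.2 fun k => ?_
  refine ae_of_ae_map
    (f := fun ρ : ℕ → α => (Preorder.frestrictLe (π := fun _ => α) k ρ, ρ (k + 1)))
    (p := fun x => M.step (x.1 ⟨k, Finset.mem_Iic.2 le_rfl⟩) x.2 ≠ 0) (by fun_prop) ?_
  rw [law, ← Kernel.map_frestrictLe_trajMeasure_compProd_eq_map_trajMeasure]
  refine Measure.ae_compProd_of_ae_ae (.of_discrete) (Eventually.of_forall fun h => ?_)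
  change ∀ᵐ s ∂(M.step _).toMeasure, _
  rw [ae_iff, PMF.toMeasure_apply_eq_zero_iff _ (.of_discrete)]
  exact Set.disjoint_left.2 fun s hs hs' => hs' hs

/-- If, at each time `k` with `ρ ∈ A k`, the chain moves to `t (ρ k)` with probability at least
`c > 0`, then almost surely, if `A k` occurs infinitely often, so does the move. -/
theorem ae_frequently_step (M : MarkovChain α) (A : ℕ → Set (ℕ → α))
    (hdep : ∀ k ρ ρ', (∀ i ≤ k, ρ i = ρ' i) → ρ ∈ A k → ρ' ∈ A k)
    (t : α → α) {c : ℝ≥0∞} (hc : c ≠ 0)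
    (hstep : ∀ k, ∀ ρ ∈ A k, c ≤ M.step (ρ k) (t (ρ k))) :
    ∀ᵐ ρ ∂M.law, (∃ᶠ k in atTop, ρ ∈ A k) → ∃ᶠ k in atTop, ρ ∈ A k ∧ ρ (k + 1) = t (ρ k) := by
  classical
  -- If every `A k` is empty the claim is vacuous; otherwise `c` is at most a probability, hence
  -- finite, so that `c.toReal` is positive.
  by_cases hne : ∃ k ρ, ρ ∈ A k
  swap
  · push Not at hne
    refine Eventually.of_forall fun ρ hρ => ?_
    obtain ⟨k, hk⟩ := hρ.exists
    exact absurd hk (hne k ρ)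
  have hctop : c ≠ ∞ := by
    obtain ⟨k, ρ, hρ⟩ := hne
    exact ne_top_of_le_ne_top ((M.step (ρ k)).apply_ne_top _) (hstep k ρ hρ)
  have : Nonempty α := ⟨M.init.support_nonempty.some⟩
  let X (k : ℕ) : (ℕ → α) → (Finset.Iic k → α) := Preorder.frestrictLe (π := fun _ => α) k
  have hX (k) : Measurable (X k) := by fun_prop
  let B (k : ℕ) : Set ((Finset.Iic k → α) × α) :=
    {x | x.1 ∈ X k '' A k ∧ x.2 = t (x.1 ⟨k, Finset.mem_Iic.2 le_rfl⟩)}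
  have hXA (k ρ) : X k ρ ∈ X k '' A k ↔ ρ ∈ A k := by
    refine ⟨?_, fun h => ⟨ρ, h, rfl⟩⟩
    rintro ⟨ρ', h, he⟩
    exact hdep k ρ' ρ (fun i hi => congrFun he ⟨i, Finset.mem_Iic.2 hi⟩) h
  -- The move out of time `k` is an event at time `k + 1`; the shift makes `s` adapted to the
  -- filtration.
  let s : ℕ → Set (ℕ → α)
    | 0 => ∅
    | k + 1 => {ρ | (X k ρ, ρ (k + 1)) ∈ B k}
  have hsmeas (n : ℕ) : MeasurableSet[Filtration.piLE (X := fun _ : ℕ => α) n] (s n) := by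
    rw [Filtration.piLE_eq_comap_frestrictLe]
    cases n with
    | zero => exact @MeasurableSet.empty _ (_)
    | succ k =>
      refine ⟨{h | ((fun i : Finset.Iic k => h ⟨i, Finset.mem_Iic.2
        ((Finset.mem_Iic.1 i.2).trans k.le_succ)⟩), h ⟨k + 1, Finset.mem_Iic.2 le_rfl⟩) ∈ B k},
        .of_discrete, rfl⟩
  have hcond (k : ℕ) : ∀ᵐ ρ ∂M.law, ρ ∈ A k →
      c.toReal ≤ (M.law[(s (k + 1)).indicator (1 : (ℕ → α) → ℝ) |
        Filtration.piLE (X := fun _ : ℕ => α) k]) ρ := by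
    have h1 := condExp_prod_ae_eq_integral_condDistrib (μ := M.law) (X := X k)
      (Y := fun ρ => ρ (k + 1)) (f := (B k).indicator (1 : (Finset.Iic k → α) × α → ℝ)) (hX k)
      (measurable_pi_apply (k + 1)).aemeasurable
      (stronglyMeasurable_one.indicator .of_discrete)
      ((integrable_const (1 : ℝ)).indicator (s := s (k + 1))
        ((Filtration.piLE (X := fun _ : ℕ => α)).le _ _ (hsmeas (k + 1))))
    have h2 : ∀ᵐ ρ ∂M.law, condDistrib (fun ρ : ℕ → α => ρ (k + 1)) (X k) M.law (X k ρ)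
        = M.kernel k (X k ρ) :=
      ae_of_ae_map (hX k).aemeasurable Kernel.condDistrib_trajMeasure
    rw [Filtration.piLE_eq_comap_frestrictLe]
    filter_upwards [h1, h2] with ρ h1 h2 hρ
    refine le_of_le_of_eq ?_ h1.symm
    rw [h2]
    have hind : (fun y => (B k).indicator (1 : (Finset.Iic k → α) × α → ℝ) (X k ρ, y)) =
        ({t (ρ k)} : Set α).indicator 1 := by
      ext y
      have : (X k ρ, y) ∈ B k ↔ y ∈ ({t (ρ k)} : Set α) := by
        simp only [B, Set.mem_ofPred_eq, hXA, hρ, true_and, Set.mem_singleton_iff]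
        rfl
      by_cases hy : y ∈ ({t (ρ k)} : Set α)
      · rw [Set.indicator_of_mem hy, Set.indicator_of_mem (this.2 hy)]; rfl
      · rw [Set.indicator_of_notMem hy, Set.indicator_of_notMem (fun h => hy (this.1 h))]
    rw [hind, integral_indicator_one (.of_discrete)]
    change c.toReal ≤ ((M.step (ρ k)).toMeasure {t (ρ k)}).toReal
    rw [PMF.toMeasure_apply_singleton _ _ (.of_discrete)]
    exact ENNReal.toReal_mono ((M.step (ρ k)).apply_ne_top _) (hstep k ρ hρ)
  have hnn (k : ℕ) : ∀ᵐ ρ ∂M.law, 0 ≤ (M.law[(s (k + 1)).indicator (1 : (ℕ → α) → ℝ) |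
        Filtration.piLE (X := fun _ : ℕ => α) k]) ρ :=
    condExp_nonneg (Eventually.of_forall fun ρ =>
      Set.indicator_nonneg (fun _ _ => zero_le_one) ρ)
  -- Lévy's criterion: `s n` occurs infinitely often iff the conditional probabilities sum to
  -- infinity. Here infinitely many terms are at least `c` and the others are nonnegative.
  filter_upwards [ae_mem_limsup_atTop_iff M.law hsmeas, ae_all_iff.2 hcond, ae_all_iff.2 hnn]
    with ρ hlim hle hnn hfreq
  have hmem : ρ ∈ limsup s atTop := by
    refine hlim.2 ?_
    refine (tendsto_atTop_mono (fun n => ?_)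
      ((Set.infinite_iff_tendsto_sum_indicator_atTop (s := {k | ρ ∈ A k})
        (ENNReal.toReal_pos hc hctop)).1 (Nat.frequently_atTop_iff_infinite.1 hfreq)))
    refine Finset.sum_le_sum fun k _ => ?_
    by_cases hk : ρ ∈ A k
    · rw [Set.indicator_of_mem (by exact hk)]; exact hle k hk
    · rw [Set.indicator_of_notMem (by exact hk)]; exact hnn k
  have hfr : ∃ᶠ n in atTop, ρ ∈ s n := mem_limsup_iff_frequently_mem.1 hmem
  rw [frequently_atTop] at hfr ⊢
  intro a
  obtain ⟨b, hb, hs⟩ := hfr (a + 1)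
  obtain ⟨k, rfl⟩ : ∃ k, b = k + 1 := ⟨b - 1, by omega⟩
  exact ⟨k, by omega, (hXA k ρ).1 hs.1, hs.2⟩

end MarkovChain

/-! ### Paths and candidates -/

section Paths

variable {V : Type*}

/-- Inductive description of the edges of `pathGraph`: extending a path contributes only the edge
out of its old last entry. -/
theorem pair_infix_concat_iff {π : List V} {a b p : V} :
    [a, b] <:+: π ++ [p] ↔ [a, b] <:+: π ∨ π.getLast? = some a ∧ b = p := by
  rw [List.infix_concat_iff, or_comm]
  refine or_congr_right ?_
  constructor
  · rintro ⟨s, hs⟩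
    have : (s ++ [a]) ++ [b] = π ++ [p] := by simpa using hs
    obtain ⟨h1, h2⟩ := List.append_inj' this rfl
    refine ⟨?_, by simpa using h2⟩
    rw [← h1]; simp
  · rintro ⟨h, rfl⟩
    obtain ⟨s, rfl⟩ := List.getLast?_eq_some_iff.1 h
    exact ⟨s, by simp⟩

theorem pair_infix_map_range_iff {w : ℕ → V} {k : ℕ} {a b : V} :
    [a, b] <:+: (List.range k).map w ↔ ∃ i, i + 1 < k ∧ w i = a ∧ w (i + 1) = b := by
  induction k with
  | zero => simp
  | succ k ih =>
    rw [List.range_succ, List.map_append, List.map_singleton, pair_infix_concat_iff, ih]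
    constructor
    · rintro (⟨i, hi, h⟩ | ⟨h, rfl⟩)
      · exact ⟨i, by omega, h⟩
      · cases k with
        | zero => simp at h
        | succ k =>
          rw [List.range_succ] at h
          exact ⟨k, by omega, by simpa using h, rfl⟩
    · rintro ⟨i, hi, rfl, rfl⟩
      rcases Nat.lt_or_ge (i + 1) k with h | h
      · exact Or.inl ⟨i, h, rfl, rfl⟩
      · obtain rfl : k = i + 1 := by omega
        exact Or.inr ⟨by rw [List.range_succ]; simp, rfl⟩

/-- Every entry of a path is connected to the last entry in the graph of the path. -/
theorem reflTransGen_getLast {π : List V} {p x : V} (hp : π.getLast? = some p) (hx : x ∈ π) :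
    Relation.ReflTransGen (fun a b => [a, b] <:+: π) x p := by
  induction π using List.reverseRecOn generalizing p x with
  | nil => simp at hx
  | append_singleton π q ih =>
    obtain rfl : q = p := by simpa using hp
    rcases List.mem_append.1 hx with hx | hx
    · obtain ⟨r, hr⟩ : ∃ r, π.getLast? = some r :=
        ⟨_, List.getLast?_eq_some_getLast (List.ne_nil_of_mem hx)⟩
      exact (Relation.ReflTransGen.mono (fun a b h => pair_infix_concat_iff.2 (.inl h)) _ _
        (ih hr hx)).tail
        (pair_infix_concat_iff.2 (.inr ⟨hr, rfl⟩))
    · obtain rfl : x = q := by simpa using hx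
      exact .refl

/-- Loop erasure: if the new head already occurs, keep only the part of the path from that
occurrence on. -/
theorem exists_nodup_isChain {E : V → V → Prop} {v f : V} (h : Relation.ReflTransGen E v f) :
    ∃ l, List.IsChain E (v :: l) ∧ (v :: l).Nodup ∧ (v :: l).getLast? = some f := by
  induction h using Relation.ReflTransGen.head_induction_on with
  | refl => exact ⟨[], by simp⟩
  | @head a c hac _ ih =>
    obtain ⟨l, hl, hnd, hlast⟩ := ih
    by_cases ha : a ∈ c :: l
    · obtain ⟨s, t, hst⟩ := List.append_of_mem ha
      rw [hst] at hl hnd hlast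
      refine ⟨t, hl.right_of_append, hnd.of_append_right, ?_⟩
      simpa [List.getLast?_append] using hlast
    · exact ⟨c :: l, List.isChain_cons_cons.2 ⟨hac, hl⟩, List.nodup_cons.2 ⟨ha, hnd⟩,
        by simpa [List.getLast?_cons] using hlast⟩

/-- The entries that an infinite path visits infinitely often. -/
def infSet (w : ℕ → V) : Set V := {p | ∃ᶠ k in atTop, w k = p}

theorem infSet_nonempty [Finite V] (w : ℕ → V) : (infSet w).Nonempty := by
  by_contra h
  rw [Set.not_nonempty_iff_eq_empty] at h
  have h1 : ∀ p, ∀ᶠ k in atTop, w k ≠ p := fun p => by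
    have : p ∉ infSet w := by simp [h]
    exact not_frequently.1 this
  obtain ⟨k, hk⟩ := (eventually_all.2 h1).exists
  exact hk _ rfl

theorem reflTransGen_of_le {E : V → V → Prop} {w : ℕ → V} (hw : ∀ k, E (w k) (w (k + 1)))
    {i j : ℕ} (hij : i ≤ j) : Relation.ReflTransGen E (w i) (w j) := by
  induction j, hij using Nat.le_induction with
  | base => exact .refl
  | succ j _ ih => exact ih.tail (hw j)

/-- If the set of entries that an infinite path visits infinitely often is closed under the possible
moves, it is the candidate of some finite initial segment. -/
theorem exists_isCandidate_infSet [Finite V] {E : V → V → Prop} {w : ℕ → V}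
    (hw : ∀ k, E (w k) (w (k + 1)))
    (hcl : ∀ p ∈ infSet w, ∀ p', E p p' → p' ∈ infSet w) :
    ∃ k, IsCandidate ((List.range k).map w) (infSet w) := by
  classical
  have hex : ∃ T, w T ∈ infSet w := by
    obtain ⟨p, hp⟩ := infSet_nonempty w
    obtain ⟨T, hT⟩ := hp.exists
    exact ⟨T, by rwa [hT]⟩
  let T := Nat.find hex
  have hT : w T ∈ infSet w := Nat.find_spec hex
  have hTmin : ∀ i, w i ∈ infSet w → T ≤ i := fun i hi => Nat.find_min' hex hi
  have hTge : ∀ j, T ≤ j → w j ∈ infSet w := fun j hj => by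
    induction j, hj using Nat.le_induction with
    | base => exact hT
    | succ j _ ih => exact hcl _ ih _ (hw j)
  have hvisit : ∀ a : ℕ, ∃ b, ∀ p ∈ infSet w, ∃ i, a ≤ i ∧ i < b ∧ w i = p := fun a => by
    have : ∀ p : V, ∀ᶠ b in atTop, p ∈ infSet w → ∃ i, a ≤ i ∧ i < b ∧ w i = p := fun p => by
      by_cases hp : p ∈ infSet w
      · obtain ⟨i, hi, hip⟩ := frequently_atTop.1 hp a
        filter_upwards [eventually_gt_atTop i] with b hb _ using ⟨i, hi, hb, hip⟩
      · exact Eventually.of_forall fun b h => absurd h hp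
    obtain ⟨b, hb⟩ := (eventually_all.2 this).exists
    exact ⟨b, hb⟩
  -- Two full rounds through the infinity set from its first entry time `T`: any `v` seen in the
  -- first round is followed by any `v'` seen in the second, at distance at least one, which gives
  -- strong connectivity even for `v = v'`.
  obtain ⟨b, hb⟩ := hvisit T
  obtain ⟨c, hc⟩ := hvisit b
  have hTc : T ≤ c := by
    obtain ⟨i, h1, h2, -⟩ := hb _ hT
    obtain ⟨j, h3, h4, -⟩ := hc _ hT
    omega
  obtain ⟨m, rfl⟩ := Nat.exists_eq_add_of_le hTc
  let w' : ℕ → V := fun i => w (T + i)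
  let κ := (List.range m).map w'
  have hκ : (List.range (T + m)).map w = (List.range T).map w ++ κ := by
    rw [List.range_add, List.map_append, List.map_map]; rfl
  have hverts : (pathGraph κ).verts = infSet w := by
    ext v
    simp only [pathGraph, κ, w', Set.mem_ofPred_eq, List.mem_map, List.mem_range]
    constructor
    · rintro ⟨i, -, rfl⟩
      exact hTge _ (by omega)
    · intro hv
      obtain ⟨i, h1, h2, rfl⟩ := hc v hv
      obtain ⟨j, h3, h4, -⟩ := hb _ hT
      have : T ≤ i := by omega
      exact ⟨i - T, by omega, by congr 1; omega⟩
  have hκedge : ∀ {x y}, (x, y) ∈ (pathGraph κ).edges ↔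
      ∃ i, i + 1 < m ∧ w' i = x ∧ w' (i + 1) = y := pair_infix_map_range_iff
  have hedge : ∀ {x y}, (x, y) ∈ (pathGraph ((List.range (T + m)).map w)).edges ↔
      ∃ i, i + 1 < T + m ∧ w i = x ∧ w (i + 1) = y := pair_infix_map_range_iff
  have hconn : (pathGraph κ).StronglyConnected := by
    refine ⟨hverts ▸ ⟨_, hT⟩, fun v hv v' hv' => ?_⟩
    rw [hverts] at hv hv'
    obtain ⟨i, hi1, hi2, rfl⟩ := hb v hv
    obtain ⟨j, hj1, hj2, rfl⟩ := hc v' hv'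
    have key : ∀ n, i + (n + 1) < T + m → Relation.TransGen
        (fun a b => (a, b) ∈ (pathGraph κ).edges) (w i) (w (i + (n + 1))) := by
      have hstep : ∀ n, T ≤ n → n + 1 < T + m → (w n, w (n + 1)) ∈ (pathGraph κ).edges := by
        intro n h1 h2
        refine hκedge.2 ⟨n - T, by omega, ?_, ?_⟩ <;> simp only [w'] <;> congr 1 <;> omega
      intro n
      induction n with
      | zero => exact fun h => .single (hstep i hi1 h)
      | succ n ih => exact fun h => (ih (by omega)).tail (hstep (i + (n + 1)) (by omega) h)
    have := key (j - i - 1) (by omega)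
    rwa [show i + (j - i - 1 + 1) = j by omega] at this
  have hsuff : κ <:+ (List.range (T + m)).map w := ⟨_, hκ.symm⟩
  refine ⟨T + m, κ, hsuff, ⟨⟨⟨fun v hv => hsuff.subset hv,
    fun e he => List.IsInfix.trans he hsuff.isInfix⟩, hconn, ?_⟩, ?_⟩, hverts.symm⟩
  · intro H' h1 h2 h3
    -- Closure under moves: edges cannot lead from the infinity set to anything outside it.
    have hH : H'.verts = (pathGraph κ).verts := by
      refine Set.Subset.antisymm (fun v hv => ?_) h1.1
      obtain ⟨a, ha⟩ := hconn.1
      have hav := h3.2 a (h1.1 ha) v hv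
      rw [hverts] at ha ⊢
      clear hv
      induction hav with
      | single h =>
        obtain ⟨i, -, rfl, rfl⟩ := hedge.1 (h2.2 h)
        exact hcl _ ha _ (hw i)
      | tail _ h ih =>
        obtain ⟨i, -, rfl, rfl⟩ := hedge.1 (h2.2 h)
        exact hcl _ ih _ (hw i)
    refine DirGraph.ext hH (Set.Subset.antisymm ?_ h1.2)
    rintro ⟨x, y⟩ hxy
    have hx : x ∈ infSet w := hverts ▸ hH ▸ (H'.edges_subset hxy).1
    obtain ⟨i, hi, rfl, rfl⟩ := hedge.1 (h2.2 hxy)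
    -- An edge starting in the infinity set is traversed no earlier than `T`, so it already lies in
    -- `κ`.
    have := hTmin i hx
    refine hκedge.2 ⟨i - T, by omega, ?_, ?_⟩ <;> simp only [w'] <;> congr 1 <;> omega
  · intro v v' hv h
    rw [hverts] at hv ⊢
    obtain ⟨i, -, rfl, rfl⟩ := hedge.1 h
    exact hcl _ hv _ (hw i)

end Paths

/-! ### Safe paths -/

section Safe

variable {V : Type*} (N : MarkovChain V)

@[simp]
theorem MarkovChain.nextState_nil : N.nextState [] = N.init := rfl

@[simp]
theorem MarkovChain.nextState_concat (π : List V) (q : V) : N.nextState (π ++ [q]) = N.step q := by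
  simp [MarkovChain.nextState]

/-- `N.Moves p q`: the chain moves from `p` to `q` with positive probability. -/
def MarkovChain.Moves (p q : V) : Prop := N.step p q ≠ 0

/-- Paths of positive probability such that every entry either is new or can get back to `f` along
the edges seen so far. -/
inductive SafePath (f : V) : List V → Prop
  | nil : SafePath f []
  | concat {π : List V} {p : V} : SafePath f π → N.nextState π p ≠ 0 →
      (p ∉ π ∨ Relation.ReflTransGen (fun a b => [a, b] <:+: π) p f) → SafePath f (π ++ [p])

namespace SafePath

variable {N} {f : V}

theorem moves {π : List V} (h : SafePath N f π) {a b : V} (hab : [a, b] <:+: π) :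
    N.Moves a b := by
  induction h with
  | nil => simp at hab
  | @concat π p _ hp _ ih =>
    rcases pair_infix_concat_iff.1 hab with hab | ⟨hlast, rfl⟩
    · exact ih hab
    · obtain ⟨s, rfl⟩ := List.getLast?_eq_some_iff.1 hlast
      simpa [MarkovChain.Moves] using hp

/-- The last entry lies in the candidate. If it were new it would have no outgoing edge,
contradicting strong connectivity; so it reaches `f` along the path graph, and a bottom component
cannot be left. Strong connectivity then makes all of `K` reachable from `f`. -/
theorem mem_candidate {π : List V} (h : SafePath N f π) {K : Set V} (hK : IsCandidate π K) :
    f ∈ K ∧ ∀ v ∈ K, Relation.ReflTransGen N.Moves f v := by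
  obtain ⟨κ, hsuff, hbscc, rfl⟩ := hK
  have hf : f ∈ κ := by
    obtain ⟨v, hv⟩ := hbscc.1.2.1.1
    have hκ : κ ≠ [] := List.ne_nil_of_mem hv
    cases h with
    | nil => exact absurd (List.suffix_nil.1 hsuff) hκ
    | @concat π p h hp hsafe =>
      have hpκ : p ∈ κ := by
        obtain ⟨s, hs⟩ := hsuff
        obtain ⟨t, q, rfl⟩ : ∃ t q, κ = t ++ [q] :=
          ⟨_, _, (List.dropLast_append_getLast hκ).symm⟩
        rw [← List.append_assoc] at hs
        have := (List.append_inj' hs rfl).2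
        simp_all
      rcases hsafe with hfresh | hreach
      · obtain ⟨c, hc, -⟩ := Relation.TransGen.head'_iff.1 (hbscc.1.2.1.2 p hpκ p hpκ)
        rcases pair_infix_concat_iff.1 (List.IsInfix.trans hc hsuff.isInfix) with hc | ⟨hc, -⟩
        · exact absurd (hc.subset (by simp)) hfresh
        · exact absurd (List.mem_of_getLast? hc) hfresh
      · clear h
        induction hreach with
        | refl => exact hpκ
        | tail _ hbc ih => exact hbscc.2 _ _ ih (pair_infix_concat_iff.2 (.inl hbc))
  refine ⟨hf, fun v hv => Relation.ReflTransGen.mono (fun a b hab => ?_) _ _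
    (hbscc.1.2.1.2 f hf v hv).to_reflTransGen⟩
  exact h.moves (List.IsInfix.trans hab hsuff.isInfix)

theorem of_nodup {l : List V} (hinit : ∀ x ∈ l.head?, N.init x ≠ 0)
    (hl : List.IsChain N.Moves l) (hnd : l.Nodup) : SafePath N f l := by
  induction l using List.reverseRecOn with
  | nil => exact .nil
  | append_singleton l p ih =>
    refine .concat (ih (fun x hx => hinit x ?_) hl.left_of_append hnd.of_append_left) ?_ (.inl ?_)
    · cases l with
      | nil => simp at hx
      | cons a l => simpa using hx
    · rcases List.eq_nil_or_concat l with rfl | ⟨s, q, rfl⟩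
      · simpa using hinit
      · simpa [MarkovChain.Moves] using (List.isChain_append.1 hl).2.2 q (by simp) p (by simp)
    · have := List.nodup_append.1 hnd
      exact fun h => this.2.2 p h p (by simp) rfl

/-- Every entry of `π` can return to `f`, the last entry of `π`; so along `l` only entries outside
`π` have to be new. -/
theorem append {π l : List V} (h : SafePath N f π) (hlast : π.getLast? = some f)
    (hl : List.IsChain N.Moves (f :: l)) (hmem : ∀ a p b, l = a ++ p :: b → p ∈ π ∨ p ∉ a) :
    SafePath N f (π ++ l) := by
  induction l using List.reverseRecOn with
  | nil => simpa using h
  | append_singleton l p ih =>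
    rw [← List.cons_append] at hl
    rw [← List.append_assoc]
    have ih := ih hl.left_of_append fun a q b hab => hmem a q (b ++ [p]) (by simp [hab])
    refine .concat ih ?_ ?_
    · have hmove : ∀ q, (f :: l).getLast? = some q → N.Moves q p := fun q hq =>
        (List.isChain_append.1 hl).2.2 q hq p (by simp)
      rcases List.eq_nil_or_concat l with rfl | ⟨s, q, rfl⟩
      · obtain ⟨s, rfl⟩ := List.getLast?_eq_some_iff.1 hlast
        simpa [MarkovChain.Moves] using hmove f (by simp)
      · rw [List.concat_eq_append] at hmove ⊢
        rw [← List.append_assoc, MarkovChain.nextState_concat]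
        exact hmove q (by simp [List.getLast?_cons])
    · by_cases hp : p ∈ π
      · exact .inr (Relation.ReflTransGen.mono (fun a b hab =>
          List.IsInfix.trans hab (List.prefix_append π l).isInfix) _ _
          (reflTransGen_getLast hlast hp))
      · have := (hmem l p [] rfl).resolve_left hp
        exact .inl (by simp [hp, this])

/-- To add the last entry `v`, retrace the already covered part of `l`, step to `v`, and return to
`f` by a loop-free path. What is not yet covered lies on this return path and occurs there only
once, so safety is preserved. -/
theorem exists_covering_isChain
    (hret : ∀ v, Relation.ReflTransGen N.Moves f v → Relation.ReflTransGen N.Moves v f)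
    {π : List V} (h : SafePath N f π) (hlast : π.getLast? = some f)
    (l : List V) (hl : List.IsChain N.Moves (f :: l)) :
    ∃ π', SafePath N f π' ∧ π'.getLast? = some f ∧ (∀ x ∈ π, x ∈ π') ∧ ∀ x ∈ l, x ∈ π' := by
  induction l using List.reverseRecOn with
  | nil => exact ⟨π, h, hlast, fun x hx => hx, by simp⟩
  | append_singleton l v ih =>
    have hl' := hl
    rw [← List.cons_append] at hl
    obtain ⟨π', h', hlast', hsub, hcov⟩ := ih hl.left_of_append
    have hv : Relation.ReflTransGen N.Moves f v :=
      (List.relationReflTransGen_of_exists_isChain_cons (l ++ [v]) hl' (by simp))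
    obtain ⟨r, hr, hnd, hrlast⟩ := exists_nodup_isChain (hret v hv)
    have happ : SafePath N f (π' ++ (l ++ v :: r)) := by
      refine h'.append hlast' ?_ fun a p b hab => ?_
      · rw [← List.cons_append]
        exact List.isChain_append.2 ⟨hl.left_of_append, hr, fun x hx y hy =>
          (List.isChain_append.1 hl).2.2 x hx y (by simpa using hy)⟩
      -- Either `p` lies on the return path `v :: r` or on the retraced `l`; an empty `t` in the
      -- second case makes `p` equal to `v`.
      · rcases List.append_eq_append_iff.1 hab with ⟨t, rfl, ht⟩ | ⟨t, rfl, ht⟩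
        · rw [or_iff_not_imp_left]
          intro hp hpa
          rcases List.mem_append.1 hpa with hpl | hpt
          · exact hp (hcov p hpl)
          · rw [ht] at hnd
            exact (List.nodup_append.1 hnd).2.2 p hpt p (by simp) rfl
        · cases t with
          | nil =>
            rw [or_iff_not_imp_left]
            intro hp hpa
            exact hp (hcov p (by simpa using hpa))
          | cons q t =>
            obtain ⟨rfl, -⟩ := List.cons.inj ht
            exact .inl (hcov _ (by simp))
    refine ⟨_, happ, ?_, fun x hx => by simp [hsub x hx], fun x hx => ?_⟩
    · rw [← List.append_assoc, List.getLast?_append, hrlast]; rfl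
    · rcases List.mem_append.1 hx with hx | hx
      · simp [hcov x hx]
      · obtain rfl : x = v := by simpa using hx
        simp

theorem exists_covering [Finite V]
    (hret : ∀ v, Relation.ReflTransGen N.Moves f v → Relation.ReflTransGen N.Moves v f)
    {π : List V} (h : SafePath N f π)
    (hlast : π.getLast? = some f) :
    ∃ π', SafePath N f π' ∧ π'.getLast? = some f ∧
      ∀ v, Relation.ReflTransGen N.Moves f v → v ∈ π' := by
  classical
  have := Fintype.ofFinite V
  have key : ∀ s : Finset V, ∃ π', SafePath N f π' ∧ π'.getLast? = some f ∧
      ∀ v ∈ s, Relation.ReflTransGen N.Moves f v → v ∈ π' := by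
    intro s
    induction s using Finset.induction_on with
    | empty => exact ⟨π, h, hlast, by simp⟩
    | insert v s _ ih =>
      obtain ⟨π', h', hlast', hcov⟩ := ih
      by_cases hv : Relation.ReflTransGen N.Moves f v
      · obtain ⟨l, hl, hlv⟩ := List.exists_isChain_cons_of_relationReflTransGen hv
        obtain ⟨π'', h'', hlast'', hsub, hcov'⟩ := h'.exists_covering_isChain hret hlast' l hl
        refine ⟨π'', h'', hlast'', fun x hx hfx => ?_⟩
        rcases Finset.mem_insert.1 hx with rfl | hx
        · have : x ∈ f :: l := by rw [← hlv]; exact List.getLast_mem _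
          rcases List.mem_cons.1 this with rfl | hxl
          · exact List.mem_of_getLast? hlast''
          · exact hcov' x hxl
        · exact hsub x (hcov x hx hfx)
      · refine ⟨π', h', hlast', fun x hx hfx => ?_⟩
        rcases Finset.mem_insert.1 hx with rfl | hx
        · exact absurd hfx hv
        · exact hcov x hx hfx
  obtain ⟨π', h1, h2, h3⟩ := key Finset.univ
  exact ⟨π', h1, h2, fun v => h3 v (Finset.mem_univ v)⟩

theorem append_of_covering {π l : List V} (h : SafePath N f π) (hlast : π.getLast? = some f)
    (hcov : ∀ v, Relation.ReflTransGen N.Moves f v → v ∈ π)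
    (hl : List.IsChain N.Moves (f :: l)) : SafePath N f (π ++ l) := by
  refine h.append hlast hl fun a p b hab => .inl (hcov p ?_)
  subst hab
  rw [← List.cons_append, List.append_cons] at hl
  exact List.relationReflTransGen_of_exists_isChain_cons (a ++ [p]) hl.left_of_append (by simp)

end SafePath

end Safe

/-! ### Image distributions and events of full measure -/

theorem apply_le_map_apply {α β : Type*} (p : PMF α) (g : α → β) (a : α) :
    p a ≤ p.map g (g a) := by
  classical
  rw [PMF.map_apply]
  refine le_trans ?_ (ENNReal.le_tsum a)
  simp

theorem map_apply_ne_zero_iff {α β : Type*} (p : PMF α) (g : α → β) (b : β) :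
    p.map g b ≠ 0 ↔ ∃ a, p a ≠ 0 ∧ g a = b := by
  rw [← PMF.mem_support_iff, PMF.mem_support_map_iff]
  rfl

theorem measure_eq_one_of_ae_mem {α : Type*} [MeasurableSpace α] {μ : Measure α}
    [IsProbabilityMeasure μ] {s : Set α} (h : ∀ᵐ x ∂μ, x ∈ s) : μ s = 1 := by
  rw [measure_congr (eventuallyEq_univ.2 h : s =ᵐ[μ] Set.univ), measure_univ]

/-! ### Runs of the product chain -/

theorem RabinAutomaton.run_congr {Q Ap : Type*} {A : RabinAutomaton Q Ap} {w w' : ℕ → Set Ap}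
    {k : ℕ} (h : ∀ i < k, w i = w' i) :
    A.run w k = A.run w' k := by
  induction k with
  | zero => rfl
  | succ k ih =>
    rw [RabinAutomaton.run, RabinAutomaton.run, ih fun i hi => h i (by omega), h k (by omega)]

section Product

variable {S Q Ap : Type*} (M : LabelledMarkovChain S Ap) (A : RabinAutomaton Q Ap)

theorem product_init_ne_zero_iff (p : S × Q) :
    (product M A).init p ≠ 0 ↔ M.init p.1 ≠ 0 ∧ p.2 = A.trans A.start (M.label p.1) := by
  rw [product, map_apply_ne_zero_iff]
  constructor
  · rintro ⟨s, hs, rfl⟩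
    exact ⟨hs, rfl⟩
  · rintro ⟨h1, h2⟩
    exact ⟨p.1, h1, Prod.ext rfl h2.symm⟩

theorem product_moves_iff (p p' : S × Q) :
    (product M A).Moves p p' ↔ M.step p.1 p'.1 ≠ 0 ∧ p'.2 = A.trans p.2 (M.label p'.1) := by
  rw [MarkovChain.Moves, product, map_apply_ne_zero_iff]
  constructor
  · rintro ⟨s, hs, rfl⟩
    exact ⟨hs, rfl⟩
  · rintro ⟨h1, h2⟩
    exact ⟨p'.1, h1, Prod.ext rfl h2.symm⟩

variable {M A} {w : ℕ → S × Q}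

/-- The index is shifted because the automaton component of `w k` has already read the label of `w
k`. -/
theorem run_succ_eq_snd (hinit : (product M A).init (w 0) ≠ 0)
    (hw : ∀ k, (product M A).Moves (w k) (w (k + 1))) (k : ℕ) :
    A.run (fun i => M.label (w i).1) (k + 1) = (w k).2 := by
  induction k with
  | zero => exact ((product_init_ne_zero_iff M A _).1 hinit).2.symm
  | succ k ih =>
    rw [RabinAutomaton.run, ih]
    exact ((product_moves_iff M A _ _).1 (hw k)).2.symm

theorem mem_infStates_iff [Finite S] (hinit : (product M A).init (w 0) ≠ 0)
    (hw : ∀ k, (product M A).Moves (w k) (w (k + 1))) (q : Q) :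
    q ∈ A.infStates (fun i => M.label (w i).1) ↔ ∃ s, (s, q) ∈ infSet w := by
  constructor
  · intro hq
    by_contra! h
    have h1 : ∀ s, ∀ᶠ k in atTop, w k ≠ (s, q) := fun s => not_frequently.1 (h s)
    obtain ⟨N, hN⟩ := eventually_atTop.1 (eventually_all.2 h1)
    obtain ⟨n, hn, hnq⟩ := hq (N + 1)
    obtain ⟨k, rfl⟩ : ∃ k, n = k + 1 := ⟨n - 1, by omega⟩
    rw [run_succ_eq_snd hinit hw] at hnq
    exact hN k (by omega) (w k).1 (Prod.ext rfl hnq)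
  · rintro ⟨s, hs⟩ N
    obtain ⟨k, hk, hks⟩ := frequently_atTop.1 hs N
    exact ⟨k + 1, by omega, by rw [run_succ_eq_snd hinit hw, hks]⟩

theorem accepts_iff_goodSet [Finite S] (hinit : (product M A).init (w 0) ≠ 0)
    (hw : ∀ k, (product M A).Moves (w k) (w (k + 1))) :
    A.Accepts (fun i => M.label (w i).1) ↔ GoodSet A (infSet w) := by
  refine exists_congr fun P => and_congr_right fun _ => and_congr ?_ ?_
  · simp only [Set.eq_empty_iff_forall_notMem, Set.mem_inter_iff, mem_infStates_iff hinit hw,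
      Set.mem_prod, Set.mem_univ, true_and, not_and, Prod.forall]
    exact ⟨fun h s q hs => h q ⟨s, hs⟩, fun h q ⟨s, hs⟩ => h s q hs⟩
  · constructor
    · rintro ⟨q, hq, hP⟩
      obtain ⟨s, hs⟩ := (mem_infStates_iff hinit hw q).1 hq
      exact ⟨(s, q), hs, trivial, hP⟩
    · rintro ⟨⟨s, q⟩, hs, -, hP⟩
      exact ⟨q, (mem_infStates_iff hinit hw q).2 ⟨s, hs⟩, hP⟩

end Product

/-! ### From positive probability to a safe tour of a good closed set -/

section Accepting

variable {S Q Ap : Type*} [Finite S] [Finite Q] [MeasurableSpace S] [DiscreteMeasurableSpace S]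
  {M : LabelledMarkovChain S Ap} {A : RabinAutomaton Q Ap} {φ : LTL Ap}

/-- If `φ` has positive probability, some run of the product chain whose set of states visited
infinitely often is closed under the possible moves is accepted. -/
theorem exists_accepted_run (hA : A.Recognizes φ) (hpos : 0 < M.probSat φ) :
    ∃ w : ℕ → S × Q, (product M A).init (w 0) ≠ 0 ∧
      (∀ k, (product M A).Moves (w k) (w (k + 1))) ∧
      (∀ p ∈ infSet w, ∀ p', (product M A).Moves p p' → p' ∈ infSet w) ∧
      GoodSet A (infSet w) := by
  let W (ρ : ℕ → S) (k : ℕ) : S × Q := (ρ k, A.run (fun i => M.label (ρ i)) (k + 1))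
  have hcl : ∀ p p', (product M A).Moves p p' → ∀ᵐ ρ ∂M.law,
      (∃ᶠ k in atTop, W ρ k = p) → ∃ᶠ k in atTop, W ρ k = p ∧ ρ (k + 1) = p'.1 := by
    intro p p' hpp'
    refine M.ae_frequently_step (fun k => {ρ | W ρ k = p}) ?_ (fun _ => p'.1)
      ((product_moves_iff M A _ _).1 hpp').1 ?_
    · rintro k ρ ρ' h rfl
      have : A.run (fun i => M.label (ρ' i)) (k + 1) = A.run (fun i => M.label (ρ i)) (k + 1) :=
        RabinAutomaton.run_congr fun i hi => by rw [h i (by omega)]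
      simp only [W, Set.mem_ofPred_eq, this, h k le_rfl]
    · rintro k ρ rfl
      exact le_rfl
  have hcl' := ae_all_iff.2 fun p => ae_all_iff.2 fun p' => ae_all_iff.2 fun h => hcl p p' h
  -- An event of positive measure meets every event of full measure, so a single run with all the
  -- required properties can be picked.
  have hfreq : ∃ᶠ ρ in ae M.law, φ.Sat (fun i => M.label (ρ i)) := by
    intro h
    exact hpos.ne' (measure_eq_zero_iff_ae_notMem.2 h)
  obtain ⟨ρ, hsat, hcl, hinit, hstep⟩ :=
    (hfreq.and_eventually (hcl'.and (M.ae_init_ne_zero.and M.ae_step_ne_zero))).exists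
  have hinit' : (product M A).init (W ρ 0) ≠ 0 :=
    (product_init_ne_zero_iff M A _).2 ⟨hinit, rfl⟩
  have hw : ∀ k, (product M A).Moves (W ρ k) (W ρ (k + 1)) := fun k =>
    (product_moves_iff M A _ _).2 ⟨hstep k, rfl⟩
  refine ⟨W ρ, hinit', hw, fun p hp p' hpp' => ?_,
    (accepts_iff_goodSet hinit' hw).1 ((hA _).2 hsat)⟩
  refine frequently_atTop.2 fun N => ?_
  obtain ⟨k, hk, rfl, hk'⟩ := frequently_atTop.1 (hcl p p' hpp' hp) N
  refine ⟨k + 1, by omega, Prod.ext hk' ?_⟩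
  have h1 := ((product_moves_iff M A _ _).1 hpp').2
  rw [h1, ← hk']
  rfl

/-- If `φ` has positive probability, some safe path ends in a recurrent state, visits everything
reachable from that state, and no safe path for that state is bad. -/
theorem exists_safe_covering (hA : A.Recognizes φ) (hpos : 0 < M.probSat φ) :
    ∃ f π, SafePath (product M A) f π ∧ π.getLast? = some f ∧
      (∀ v, Relation.ReflTransGen (product M A).Moves f v → v ∈ π) ∧
      ∀ π', SafePath (product M A) f π' → ¬ BadPath A π' := by
  obtain ⟨w, hinit, hw, hcl, P, hP, hE, f, hf, hF⟩ := exists_accepted_run hA hpos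
  have hreach : ∀ v, Relation.ReflTransGen (product M A).Moves f v → v ∈ infSet w := by
    intro v hv
    induction hv with
    | refl => exact hf
    | tail _ h ih => exact hcl _ ih _ h
  have hret : ∀ v, Relation.ReflTransGen (product M A).Moves f v →
      Relation.ReflTransGen (product M A).Moves v f := by
    intro v hv
    obtain ⟨i, rfl⟩ := (hreach v hv).exists
    obtain ⟨j, hij, rfl⟩ := frequently_atTop.1 hf i
    exact reflTransGen_of_le hw hij
  obtain ⟨j, hj⟩ := hf.exists
  -- The approach to `f` is made loop-free so that all its entries are new, hence safe.
  obtain ⟨l, hl, hnd, hlast⟩ := exists_nodup_isChain (hj ▸ reflTransGen_of_le hw (Nat.zero_le j))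
  obtain ⟨π, hπ, hπlast, hcov⟩ := (SafePath.of_nodup (f := f) (by simpa using hinit) hl
    hnd).exists_covering hret hlast
  refine ⟨f, π, hπ, hπlast, hcov, ?_⟩
  rintro π' hπ' ⟨K, hK, hbad⟩
  obtain ⟨hfK, hKf⟩ := hπ'.mem_candidate hK
  refine hbad ⟨P, hP, ?_, f, hfK, hF⟩
  refine Set.eq_empty_of_forall_notMem fun v hv => ?_
  exact (Set.eq_empty_iff_forall_notMem.1 hE v) ⟨hreach v (hKf v hv.1), hv.2⟩

end Accepting

/-! ### Runs of the monitor -/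

section Monitor

variable {S Q Ap : Type*} {M : LabelledMarkovChain S Ap} {A : RabinAutomaton Q Ap}

instance {V : Type*} [Countable V] : Countable (MonitorState V) :=
  (show Function.Injective fun x : MonitorState V => (x.path, x.resets) from fun _ _ h =>
    MonitorState.ext (congrArg Prod.fst h) (congrArg Prod.snd h)).countable

theorem cautiousChain_step_of_bad {x y : MonitorState (S × Q)} (hx : BadPath A x.path)
    (h : (cautiousChain M A).step x y ≠ 0) : y = ⟨[], x.resets + 1⟩ := by
  simp only [cautiousChain, if_pos hx] at h
  exact (PMF.mem_support_pure_iff _ _).1 h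

theorem cautiousChain_step_of_not_bad {x y : MonitorState (S × Q)} (hx : ¬ BadPath A x.path)
    (h : (cautiousChain M A).step x y ≠ 0) :
    ∃ p, (product M A).nextState x.path p ≠ 0 ∧ y = ⟨x.path ++ [p], x.resets⟩ := by
  simp only [cautiousChain, if_neg hx] at h
  obtain ⟨p, hp, rfl⟩ := (map_apply_ne_zero_iff _ _ _).1 h
  exact ⟨p, hp, rfl⟩

theorem nextState_le_cautiousChain_step {x : MonitorState (S × Q)} (hx : ¬ BadPath A x.path)
    (p : S × Q) : (product M A).nextState x.path p ≤
      (cautiousChain M A).step x ⟨x.path ++ [p], x.resets⟩ := by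
  simp only [cautiousChain, if_neg hx]
  exact apply_le_map_apply _ (fun p => (⟨x.path ++ [p], x.resets⟩ : MonitorState (S × Q))) p

/-- `ρ` is a path of positive probability of the chain of the monitor. -/
structure IsMonitorRun (M : LabelledMarkovChain S Ap) (A : RabinAutomaton Q Ap)
    (ρ : ℕ → MonitorState (S × Q)) : Prop where
  zero : ρ 0 = ⟨[], 0⟩
  reset : ∀ k, BadPath A (ρ k).path → ρ (k + 1) = ⟨[], (ρ k).resets + 1⟩
  extend : ∀ k, ¬ BadPath A (ρ k).path →
    ∃ p, (product M A).nextState (ρ k).path p ≠ 0 ∧ ρ (k + 1) = ⟨(ρ k).path ++ [p], (ρ k).resets⟩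

/-- A stored path that occurs infinitely often is extended infinitely often in every possible way,
and a product state from which the monitor infinitely often extends the path is infinitely often
followed by each of its possible successors. -/
structure IsFairRun (M : LabelledMarkovChain S Ap) (A : RabinAutomaton Q Ap)
    (ρ : ℕ → MonitorState (S × Q)) : Prop where
  path : ∀ π p, ¬ BadPath A π → (product M A).nextState π p ≠ 0 →
    (∃ᶠ k in atTop, (ρ k).path = π) → ∃ᶠ k in atTop, (ρ k).path = π ++ [p]
  move : ∀ p p', (product M A).Moves p p' →
    (∃ᶠ k in atTop, ¬ BadPath A (ρ k).path ∧ (ρ k).path.getLast? = some p) →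
    ∃ᶠ k in atTop, (ρ k).path.getLast? = some p'

theorem frequently_of_frequently_succ {p : ℕ → Prop} (h : ∃ᶠ k in atTop, p (k + 1)) :
    ∃ᶠ k in atTop, p k := by
  refine frequently_atTop.2 fun N => ?_
  obtain ⟨k, hk, hp⟩ := frequently_atTop.1 h N
  exact ⟨k + 1, by omega, hp⟩

theorem ae_isMonitorRun [Countable S] [Countable Q] :
    ∀ᵐ ρ ∂(cautiousChain M A).law, IsMonitorRun M A ρ := by
  filter_upwards [(cautiousChain M A).ae_init_ne_zero, (cautiousChain M A).ae_step_ne_zero]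
    with ρ h0 hs
  exact ⟨(PMF.mem_support_pure_iff _ _).1 h0, fun k hk => cautiousChain_step_of_bad hk (hs k),
    fun k hk => cautiousChain_step_of_not_bad hk (hs k)⟩

theorem ae_isFairRun [Countable S] [Countable Q] :
    ∀ᵐ ρ ∂(cautiousChain M A).law, IsFairRun M A ρ := by
  have h1 : ∀ᵐ ρ ∂(cautiousChain M A).law, ∀ π p, ¬ BadPath A π →
      (product M A).nextState π p ≠ 0 →
      (∃ᶠ k in atTop, (ρ k).path = π) → ∃ᶠ k in atTop, (ρ k).path = π ++ [p] := by
    refine ae_all_iff.2 fun π => ae_all_iff.2 fun p => ae_all_iff.2 fun hπ =>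
      ae_all_iff.2 fun hp => ?_
    have := (cautiousChain M A).ae_frequently_step (fun k => {ρ | (ρ k).path = π})
      (fun k ρ ρ' h hρ => by simpa [h k le_rfl] using hρ)
      (fun x => ⟨x.path ++ [p], x.resets⟩) hp
      (by rintro k ρ rfl; exact nextState_le_cautiousChain_step hπ p)
    filter_upwards [this] with ρ hρ hfreq
    refine frequently_of_frequently_succ ((hρ hfreq).mono ?_)
    rintro k ⟨rfl, hk⟩
    rw [hk]
  -- Without further resets stored paths only grow and none recurs, so fairness is also needed in
  -- terms of the last entry alone.
  have h2 : ∀ᵐ ρ ∂(cautiousChain M A).law, ∀ p p', (product M A).Moves p p' →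
      (∃ᶠ k in atTop, ¬ BadPath A (ρ k).path ∧ (ρ k).path.getLast? = some p) →
      ∃ᶠ k in atTop, (ρ k).path.getLast? = some p' := by
    refine ae_all_iff.2 fun p => ae_all_iff.2 fun p' => ae_all_iff.2 fun hp => ?_
    have := (cautiousChain M A).ae_frequently_step
      (fun k => {ρ | ¬ BadPath A (ρ k).path ∧ (ρ k).path.getLast? = some p})
      (fun k ρ ρ' h hρ => by simpa [h k le_rfl] using hρ)
      (fun x => ⟨x.path ++ [p'], x.resets⟩) hp
      (fun k ρ ⟨hb, hl⟩ => by
        refine le_trans (le_of_eq ?_) (nextState_le_cautiousChain_step hb p')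
        obtain ⟨s, hs⟩ := List.getLast?_eq_some_iff.1 hl
        rw [hs, MarkovChain.nextState_concat])
    filter_upwards [this] with ρ hρ hfreq
    refine frequently_of_frequently_succ ((hρ hfreq).mono ?_)
    rintro k ⟨-, hk⟩
    rw [hk]
    simp
  filter_upwards [h1, h2] with ρ h1 h2 using ⟨h1, h2⟩

variable {ρ : ℕ → MonitorState (S × Q)}

/-- A fair run of the monitor resets only finitely often. -/
theorem IsMonitorRun.eventually_not_bad (hρ : IsMonitorRun M A ρ) (hfair : IsFairRun M A ρ)
    {f : S × Q} {π : List (S × Q)} (hπ : SafePath (product M A) f π) (hlast : π.getLast? = some f)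
    (hcov : ∀ v, Relation.ReflTransGen (product M A).Moves f v → v ∈ π)
    (hsafe : ∀ π', SafePath (product M A) f π' → ¬ BadPath A π') :
    ∀ᶠ k in atTop, ¬ BadPath A (ρ k).path := by
  by_contra h
  have hbad : ∃ᶠ k in atTop, BadPath A (ρ k).path := by simpa [Filter.Frequently] using h
  have hnil : ∃ᶠ k in atTop, (ρ k).path = [] :=
    frequently_of_frequently_succ (hbad.mono fun k hk => by rw [hρ.reset k hk])
  have hall : ∀ π, SafePath (product M A) f π → ∃ᶠ k in atTop, (ρ k).path = π := by
    intro π hπ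
    induction hπ with
    | nil => exact hnil
    | concat hπ hp _ ih => exact hfair.path _ _ (hsafe _ hπ) hp ih
  obtain ⟨k, hk⟩ := (hall π hπ).exists
  -- Once the covering path is stored, every later path extends it and is safe, so the monitor never
  -- resets again.
  have hext : ∀ j, k ≤ j → ∃ l, List.IsChain (product M A).Moves (f :: l) ∧
      (ρ j).path = π ++ l := by
    intro j hj
    induction j, hj using Nat.le_induction with
    | base => exact ⟨[], by simp, by simpa using hk⟩
    | succ j _ ih =>
      obtain ⟨l, hl, hjl⟩ := ih
      have hs := hπ.append_of_covering hlast hcov hl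
      obtain ⟨p, hp, hj⟩ := hρ.extend j (hjl ▸ hsafe _ hs)
      refine ⟨l ++ [p], ?_, by rw [hj, hjl, List.append_assoc]⟩
      rw [← List.cons_append]
      refine List.isChain_append.2 ⟨hl, by simp, fun x hx y hy => ?_⟩
      obtain rfl : p = y := by simpa using hy
      rw [hjl] at hp
      have hx' : (π ++ l).getLast? = some x := by
        have hx : (f :: l).getLast? = some x := hx
        rw [List.getLast?_append, hlast]
        rw [List.getLast?_cons] at hx
        cases hl : l.getLast? <;> simpa [hl] using hx
      obtain ⟨s, hs⟩ := List.getLast?_eq_some_iff.1 hx'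
      rw [hs, MarkovChain.nextState_concat] at hp
      exact hp
  obtain ⟨j, hj, hjbad⟩ := frequently_atTop.1 hbad k
  obtain ⟨l, hl, hjl⟩ := hext j hj
  exact hsafe _ (hπ.append_of_covering hlast hcov hl) (hjl ▸ hjbad)

theorem IsMonitorRun.numResets_lt_top (hρ : IsMonitorRun M A ρ)
    (h : ∀ᶠ k in atTop, ¬ BadPath A (ρ k).path) : numResets ρ < ⊤ := by
  obtain ⟨n, hn⟩ := eventually_atTop.1 h
  have hmono : Monotone fun k => (ρ k).resets := by
    refine monotone_nat_of_le_succ fun k => ?_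
    by_cases hk : BadPath A (ρ k).path
    · simp [hρ.reset k hk]
    · obtain ⟨p, -, hp⟩ := hρ.extend k hk
      simp [hp]
  have hconst : ∀ j, n ≤ j → (ρ j).resets = (ρ n).resets := by
    intro j hj
    induction j, hj using Nat.le_induction with
    | base => rfl
    | succ j hj ih =>
      obtain ⟨p, -, hp⟩ := hρ.extend j (hn j hj)
      rw [hp, ← ih]
  refine lt_of_le_of_lt (iSup_le fun k => ?_) (ENat.natCast_lt_top (ρ n).resets)
  refine Nat.cast_le.2 ?_
  rcases le_total k n with hk | hk
  · exact hmono hk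
  · exact (hconst k hk).le

theorem IsMonitorRun.exists_startsAfterLastReset (hρ : IsMonitorRun M A ρ)
    (h : ∀ᶠ k in atTop, ¬ BadPath A (ρ k).path) :
    ∃ n, StartsAfterLastReset A ρ n ∧ (ρ n).path = [] := by
  classical
  have hex := eventually_atTop.1 h
  have hstart : StartsAfterLastReset A ρ (Nat.find hex) := by
    refine ⟨Nat.find_spec hex, fun m hm => ?_⟩
    by_contra hbad
    refine Nat.find_min hex (m := m) (by omega) fun b hb => ?_
    rcases hb.eq_or_lt with rfl | hb
    · exact hbad
    · exact Nat.find_spec hex b (by omega)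
  refine ⟨_, hstart, ?_⟩
  rcases hn : Nat.find hex with _ | m
  · rw [hρ.zero]
  · rw [hρ.reset m (hstart.2 m hn)]

/-- Fairness turns the infinity set of the final path into a candidate of one of its prefixes; a bad
candidate would trigger another reset. -/
theorem IsMonitorRun.suffixSat [Finite S] [Finite Q] {φ : LTL Ap} (hA : A.Recognizes φ)
    (hρ : IsMonitorRun M A ρ) (hfair : IsFairRun M A ρ) {n : ℕ}
    (hn : ∀ m, n ≤ m → ¬ BadPath A (ρ m).path) (hnil : (ρ n).path = []) :
    SuffixSat M φ ρ n := by
  choose w hwpos hwpath using fun k => hρ.extend (n + k) (hn (n + k) (by omega))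
  have hpath : ∀ k, (ρ (n + k)).path = (List.range k).map w := by
    intro k
    induction k with
    | zero => simpa using hnil
    | succ k ih =>
      rw [← add_assoc, hwpath k, ih, List.range_succ, List.map_append, List.map_singleton]
  have hlast : ∀ k, (ρ (n + (k + 1))).path.getLast? = some (w k) := fun k => by
    rw [hpath, List.range_succ]; simp
  have hinit : (product M A).init (w 0) ≠ 0 := by
    have := hwpos 0
    rwa [hpath] at this
  have hmoves : ∀ k, (product M A).Moves (w k) (w (k + 1)) := fun k => by
    have := hwpos (k + 1)
    rwa [hpath, List.range_succ, List.map_append, List.map_singleton,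
      MarkovChain.nextState_concat] at this
  have hfreq : ∀ p, (∃ᶠ k in atTop, (ρ k).path.getLast? = some p) ↔ p ∈ infSet w := by
    refine fun p => ⟨fun h => frequently_atTop.2 fun N => ?_,
      fun h => frequently_atTop.2 fun N => ?_⟩
    · obtain ⟨k, hk, hp⟩ := frequently_atTop.1 h (n + (N + 1))
      obtain ⟨j, rfl⟩ : ∃ j, k = n + (j + 1) := ⟨k - n - 1, by omega⟩
      exact ⟨j, by omega, by simpa [hlast] using hp⟩
    · obtain ⟨k, hk, rfl⟩ := frequently_atTop.1 h N
      exact ⟨n + (k + 1), by omega, hlast k⟩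
  have hcl : ∀ p ∈ infSet w, ∀ p', (product M A).Moves p p' → p' ∈ infSet w := by
    intro p hp p' hpp'
    refine (hfreq p').1 (hfair.move p p' hpp' ?_)
    refine (((hfreq p).2 hp).and_eventually (eventually_ge_atTop n)).mono ?_
    exact fun k hk => ⟨hn k hk.2, hk.1⟩
  obtain ⟨k, hk⟩ := exists_isCandidate_infSet hmoves hcl
  have hgood : GoodSet A (infSet w) := by
    by_contra hbad
    exact hn (n + k) (by omega) ⟨_, hpath k ▸ hk, hbad⟩
  exact ⟨w, hpath, (hA _).1 ((accepts_iff_goodSet hinit hmoves).2 hgood)⟩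

theorem ae_mem_successEvent [Finite S] [Finite Q] [MeasurableSpace S] [DiscreteMeasurableSpace S]
    {φ : LTL Ap} (hA : A.Recognizes φ) (hpos : 0 < M.probSat φ) :
    ∀ᵐ ρ ∂(cautiousChain M A).law, ρ ∈ successEvent M A φ := by
  obtain ⟨f, π, hπ, hlast, hcov, hsafe⟩ := exists_safe_covering hA hpos
  filter_upwards [ae_isMonitorRun, ae_isFairRun] with ρ hρ hfair
  have hev := hρ.eventually_not_bad hfair hπ hlast hcov hsafe
  obtain ⟨n, hn, hnil⟩ := hρ.exists_startsAfterLastReset hev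
  exact ⟨hρ.numResets_lt_top hev, n, hn, hρ.suffixSat hA hfair hn.1 hnil⟩

end Monitor

end Monitoring

theorem mainTheorem1 {S Q Ap : Type*} [Finite S] [Finite Q] [Finite Ap]
    [MeasurableSpace S] [DiscreteMeasurableSpace S]
    (M : Monitoring.LabelledMarkovChain S Ap) (φ : Monitoring.LTL Ap)
    (A : Monitoring.RabinAutomaton Q Ap) (hA : A.Recognizes φ)
    (hpos : 0 < M.probSat φ) :
    (Monitoring.cautiousChain M A).law {ρ | Monitoring.numResets ρ < ⊤} = 1 ∧
    ProbabilityTheory.cond (Monitoring.cautiousChain M A).law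
        {ρ | Monitoring.numResets ρ < ⊤} (Monitoring.successEvent M A φ) = 1 ∧
    (Monitoring.cautiousChain M A).law (Monitoring.successEvent M A φ) = 1 := by
  have key := Monitoring.ae_mem_successEvent hA hpos
  have hfin := Monitoring.measure_eq_one_of_ae_mem (s := {ρ | Monitoring.numResets ρ < ⊤})
    (key.mono fun ρ hρ => hρ.1)
  have : IsProbabilityMeasure
      ((Monitoring.cautiousChain M A).law[|{ρ | Monitoring.numResets ρ < ⊤}]) :=
    cond_isProbabilityMeasure (by rw [hfin]; exact one_ne_zero)
  -- Conditioning is absolutely continuous, so the almost sure event stays almost sure.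
  exact ⟨hfin, Monitoring.measure_eq_one_of_ae_mem (cond_absolutelyContinuous.ae_le key),
    Monitoring.measure_eq_one_of_ae_mem key⟩
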